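/- A \emph{$C^\infty$-ring} is a product-preserving functor to sets from the category whose objects are the spaces $\mathbb R^n$ ($n\ge 0$) and whose morphisms are the smooth maps; equivalently, it is a set $A$ with an operation $A^n\to A$ for every smooth $f:\mathbb R^n\to\mathbb R$, compatible with projections and composition. In particular $A$ is a commutative $\mathbb R$-algebra, and for every ideal $I$ of this algebra the quotient $A/I$ is again a $C^\infty$-ring. Let $\otimes_\infty$ denote the coproduct of $C^\infty$-rings, and for $a\in A$ let $A\{a^{-1}\}$ denote the $C^\infty$-ring obtained from $A$ by universally inverting $a$ in the category of $C^\infty$-rings. The \emph{$\infty$-radical} of an ideal $I$ of $A$ is $$\sqrt[\infty]{I}:=\{g\in A : (A/I)\{g^{-1}\}\cong 0\},$$ where $g$ is written also for its class in $A/I$. For $g\in A$ let $f\mapsto f(g)$ be the $C^\infty$-morphism $A\otimes_\infty C^\infty(\mathbb R)\to A$ that is the identity on $A$ and sends the coordinate $x\in C^\infty(\mathbb R)$ to $g$. An element $g$ of a $C^\infty$-ring $A$ is \emph{$\infty$-nilpotent} if there is $f\in A\otimes_\infty C^\infty(\mathbb R)$ such that $f(g)=0$ and the image of $f$ under the morphism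 $A\otimes_\infty C^\infty(\mathbb R)\to A\otimes_\infty C^\infty(\mathbb R\setminus\{0\})$ induced by restriction of functions is invertible. \textbf{Proposition.} Let $A$ be any $C^\infty$-ring (not necessarily finitely generated), let $I$ be any ideal of $A$, and let $g\in A$. Then $$g\in\sqrt[\infty]{I}\iff\text{the class of }g\text{ in }A/I\text{ is an }\infty\text{-nilpotent element of the }C^\infty\text{-ring }A/I.$$ -/

import Mathlib

open scoped Manifold ContDiff

universe u v w

/-! ## `C^∞`-rings -/

/-- A `C^∞`-ring: a product preserving functor `ℝⁿ ↦ Aⁿ` from the category of the spaces `ℝⁿ`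
(`n ≥ 0`) and smooth maps to sets.  Such a functor is the same as a set `A` on which every smooth
`f : ℝⁿ → ℝ` acts as an operation `op f : Aⁿ → A`, compatibly with projections and with composition.
The underlying commutative ring is the one given by the operations `x₀ + x₁` and `x₀ * x₁`;
it is recorded as a parent only in order to use the language of rings and ideals, and it is
determined by the operations (`op_add`, `op_mul`). -/
class CInftyRing (A : Type u) extends CommRing A where
  op : ∀ {n : ℕ} (f : (Fin n → ℝ) → ℝ), ContDiff ℝ ∞ f → (Fin n → A) → A
  op_proj : ∀ {n : ℕ} (i : Fin n) (a : Fin n → A),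
    op (fun x : Fin n → ℝ => x i) (contDiff_apply ℝ ℝ i) a = a i
  op_comp : ∀ {n m : ℕ} (f : (Fin n → ℝ) → ℝ) (hf : ContDiff ℝ ∞ f)
    (g : Fin n → (Fin m → ℝ) → ℝ) (hg : ∀ i, ContDiff ℝ ∞ (g i)) (a : Fin m → A),
    op f hf (fun i => op (g i) (hg i) a) =
      op (fun x => f (fun i => g i x)) (hf.comp (contDiff_pi.2 hg)) a
  op_add : ∀ a : Fin 2 → A,
    op (fun x : Fin 2 → ℝ => x 0 + x 1)
      ((contDiff_apply ℝ ℝ 0).add (contDiff_apply ℝ ℝ 1)) a = a 0 + a 1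
  op_mul : ∀ a : Fin 2 → A,
    op (fun x : Fin 2 → ℝ => x 0 * x 1)
      ((contDiff_apply ℝ ℝ 0).mul (contDiff_apply ℝ ℝ 1)) a = a 0 * a 1

/-- A morphism of `C^∞`-rings: a map which commutes with all smooth operations. -/
structure CInftyHom (A : Type u) (B : Type v) [CInftyRing A] [CInftyRing B] where
  toFun : A → B
  map_op : ∀ {n : ℕ} (f : (Fin n → ℝ) → ℝ) (hf : ContDiff ℝ ∞ f) (a : Fin n → A),
    toFun (CInftyRing.op f hf a) = CInftyRing.op f hf (fun i => toFun (a i))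

namespace CInftyRing

variable {A : Type u} [CInftyRing A]

theorem op_congr {n : ℕ} {f g : (Fin n → ℝ) → ℝ} (hf : ContDiff ℝ ∞ f) (hg : ContDiff ℝ ∞ g)
    (h : f = g) (a : Fin n → A) : op f hf a = op g hg a := by
  subst h; rfl

theorem op_reindex {n m : ℕ} (f : (Fin n → ℝ) → ℝ) (hf : ContDiff ℝ ∞ f)
    (s : Fin n → Fin m) (a : Fin m → A) :
    op f hf (fun i => a (s i)) =
      op (fun x => f (fun i => x (s i)))
        (hf.comp (contDiff_pi.2 fun i => contDiff_apply ℝ ℝ (s i))) a := by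
  rw [← op_comp f hf (fun i x => x (s i)) (fun i => contDiff_apply ℝ ℝ (s i)) a]
  simp only [op_proj]

theorem op_fun_add {n : ℕ} {f g : (Fin n → ℝ) → ℝ} (hf : ContDiff ℝ ∞ f) (hg : ContDiff ℝ ∞ g)
    (a : Fin n → A) :
    op (fun x => f x + g x) (hf.add hg) a = op f hf a + op g hg a := by
  have hh : ∀ i, ContDiff ℝ ∞ ((![f, g] : Fin 2 → (Fin n → ℝ) → ℝ) i) := by
    intro i; fin_cases i <;> assumption
  have h := op_comp (A := A) _ ((contDiff_apply ℝ ℝ (0 : Fin 2)).add (contDiff_apply ℝ ℝ 1))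
    ![f, g] hh a
  rw [op_add] at h
  exact h.symm

theorem op_fun_mul {n : ℕ} {f g : (Fin n → ℝ) → ℝ} (hf : ContDiff ℝ ∞ f) (hg : ContDiff ℝ ∞ g)
    (a : Fin n → A) :
    op (fun x => f x * g x) (hf.mul hg) a = op f hf a * op g hg a := by
  have hh : ∀ i, ContDiff ℝ ∞ ((![f, g] : Fin 2 → (Fin n → ℝ) → ℝ) i) := by
    intro i; fin_cases i <;> assumption
  have h := op_comp (A := A) _ ((contDiff_apply ℝ ℝ (0 : Fin 2)).mul (contDiff_apply ℝ ℝ 1))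
    ![f, g] hh a
  rw [op_mul] at h
  exact h.symm

theorem op_fun_zero {n : ℕ} (a : Fin n → A) :
    op (fun _ => (0 : ℝ)) contDiff_const a = 0 := by
  have h := op_fun_add (A := A) (n := n) (f := fun _ => 0) (g := fun _ => 0)
    contDiff_const contDiff_const a
  rw [op_congr _ (contDiff_const (c := (0 : ℝ))) (by simp)] at h
  exact left_eq_add.mp h

theorem op_fun_one {n : ℕ} (a : Fin n → A) :
    op (fun _ => (1 : ℝ)) contDiff_const a = 1 := by
  have key : ∀ b : A, b * op (fun _ : Fin n → ℝ => (1 : ℝ)) contDiff_const a = b := by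
    intro b
    have e1 : op (fun _ : Fin n → ℝ => (1 : ℝ)) contDiff_const a =
        op (fun _ : Fin 1 → ℝ => (1 : ℝ)) contDiff_const (fun _ => b) := by
      have e2 := op_comp (A := A) (fun _ : Fin 0 → ℝ => (1 : ℝ)) contDiff_const
        (fun i => i.elim0) (fun i => i.elim0) a
      have e3 := op_comp (A := A) (fun _ : Fin 0 → ℝ => (1 : ℝ)) contDiff_const
        (fun i => i.elim0) (fun i => i.elim0) (fun _ : Fin 1 => b)
      rw [← e2, ← e3]
      congr 1
      funext i
      exact i.elim0
    rw [e1]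
    have h := op_fun_mul (A := A) (n := 1) (f := fun x => x 0) (g := fun _ => 1)
      (contDiff_apply ℝ ℝ 0) contDiff_const (fun _ => b)
    rw [op_proj] at h
    rw [← h, op_congr _ (contDiff_apply ℝ ℝ (0 : Fin 1)) (by simp), op_proj]
  simpa using key 1

theorem op_fun_sum {n : ℕ} {ι : Type*} (s : Finset ι) (f : ι → (Fin n → ℝ) → ℝ)
    (hf : ∀ i, ContDiff ℝ ∞ (f i)) (a : Fin n → A) :
    op (fun x => ∑ i ∈ s, f i x) (ContDiff.sum fun i _ => hf i) a = ∑ i ∈ s, op (f i) (hf i) a := by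
  classical
  induction s using Finset.induction_on with
  | empty => simpa using op_fun_zero a
  | insert i s hi ih =>
    rw [Finset.sum_insert hi, ← ih, ← op_fun_add]
    exact op_congr _ _ (by funext x; rw [Finset.sum_insert hi]) a

end CInftyRing

namespace CInftyHom

variable {A : Type u} {B : Type v} {C : Type w} [CInftyRing A] [CInftyRing B] [CInftyRing C]

instance : CoeFun (CInftyHom A B) (fun _ => A → B) := ⟨CInftyHom.toFun⟩

theorem ext' {φ ψ : CInftyHom A B} (h : ∀ a, φ a = ψ a) : φ = ψ := by
  cases φ; cases ψ; congr; funext a; exact h a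

/-- The underlying ring homomorphism of a morphism of `C^∞`-rings. -/
def toRingHom (φ : CInftyHom A B) : A →+* B where
  toFun := φ
  map_zero' := by
    rw [← CInftyRing.op_fun_zero (A := A) (n := 0) (fun i => i.elim0), φ.map_op,
      CInftyRing.op_fun_zero]
  map_one' := by
    rw [← CInftyRing.op_fun_one (A := A) (n := 0) (fun i => i.elim0), φ.map_op,
      CInftyRing.op_fun_one]
  map_add' := fun a b => by
    have h := CInftyRing.op_add ![a, b]
    have h' := CInftyRing.op_add (fun i => φ (![a, b] i))
    simp only [Matrix.cons_val_zero, Matrix.cons_val_one] at h h'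
    rw [← h, ← h', φ.map_op]
  map_mul' := fun a b => by
    have h := CInftyRing.op_mul ![a, b]
    have h' := CInftyRing.op_mul (fun i => φ (![a, b] i))
    simp only [Matrix.cons_val_zero, Matrix.cons_val_one] at h h'
    rw [← h, ← h', φ.map_op]

/-- The identity morphism. -/
def id (A : Type u) [CInftyRing A] : CInftyHom A A where
  toFun a := a
  map_op _ _ _ := rfl

/-- Composition of morphisms. -/
def comp (ψ : CInftyHom B C) (φ : CInftyHom A B) : CInftyHom A C where
  toFun a := ψ (φ a)
  map_op f hf a := by rw [φ.map_op, ψ.map_op]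

end CInftyHom

/-! ## Quotients by ideals -/

namespace CInftyRing

theorem contDiff_intervalIntegral {E : Type} [NormedAddCommGroup E] [NormedSpace ℝ E]
    [FiniteDimensional ℝ E] (k : ℕ) :
    ∀ {G : Type} [NormedAddCommGroup G] [NormedSpace ℝ G] [CompleteSpace G] (F : E × ℝ → G),
      ContDiff ℝ ∞ F → ContDiff ℝ k (fun x => ∫ t in (0 : ℝ)..1, F (x, t)) := by
  induction k with
  | zero =>
    intro G _ _ _ F hF
    rw [Nat.cast_zero, contDiff_zero]
    exact intervalIntegral.continuous_parametric_intervalIntegral_of_continuous' 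
      (f := fun x t => F (x, t)) hF.continuous 0 1
  | succ k ih =>
    intro G _ _ _ F hF
    have hF1 : ContDiff ℝ ∞ (fun p : E × ℝ => (fderiv ℝ F p).comp (ContinuousLinearMap.inl ℝ E ℝ)) :=
      (hF.fderiv_right (m := ∞) (by simp)).clm_comp contDiff_const
    have hd : ∀ x t, HasFDerivAt (fun y => F (y, t))
        ((fderiv ℝ F (x, t)).comp (ContinuousLinearMap.inl ℝ E ℝ)) x := by
      intro x t
      exact ((hF.differentiable (by simp)) (x, t)).hasFDerivAt.comp x
        ((hasFDerivAt_id x).prodMk (hasFDerivAt_const t x))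
    have key : ∀ x, HasFDerivAt (fun x => ∫ t in (0 : ℝ)..1, F (x, t))
        (∫ t in (0 : ℝ)..1, (fderiv ℝ F (x, t)).comp (ContinuousLinearMap.inl ℝ E ℝ)) x := by
      intro x
      obtain ⟨C, hC⟩ := ((isCompact_closedBall x 1).prod
        (isCompact_Icc (a := (0 : ℝ)) (b := 1))).exists_bound_of_continuousOn
        hF1.continuous.continuousOn
      have hc : ∀ y, Continuous fun t => F (y, t) := fun y =>
        hF.continuous.comp (by fun_prop)
      refine (intervalIntegral.hasFDerivAt_integral_of_dominated_of_fderiv_le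
        (F := fun y t => F (y, t)) (bound := fun _ => C) (s := Metric.closedBall x 1)
        (F' := fun y t => (fderiv ℝ F (y, t)).comp (ContinuousLinearMap.inl ℝ E ℝ))
        (Metric.closedBall_mem_nhds x one_pos) ?_ ?_ ?_ ?_ ?_ ?_)
      · exact Filter.Eventually.of_forall fun y => (hc y).aestronglyMeasurable
      · exact (hc x).intervalIntegrable _ _
      · exact (hF1.continuous.comp (by fun_prop : Continuous fun t : ℝ => (x, t))).aestronglyMeasurable
      · refine Filter.Eventually.of_forall fun t ht y hy => hC (y, t) ⟨hy, ?_⟩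
        rw [Set.uIoc_of_le zero_le_one] at ht
        exact ⟨ht.1.le, ht.2⟩
      · exact intervalIntegrable_const
      · exact Filter.Eventually.of_forall fun t _ y _ => hd y t
    have h2 := ih _ hF1
    rw [Nat.cast_add, Nat.cast_one, contDiff_succ_iff_fderiv]
    refine ⟨fun x => (key x).differentiableAt, by simp, ?_⟩
    rw [show fderiv ℝ (fun x => ∫ t in (0 : ℝ)..1, F (x, t)) = _ from funext fun x => (key x).fderiv]
    exact h2

/-- Hadamard's lemma. -/
theorem hadamard {n : ℕ} (f : (Fin n → ℝ) → ℝ) (hf : ContDiff ℝ ∞ f) :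
    ∃ g : Fin n → (Fin n → ℝ) × (Fin n → ℝ) → ℝ, (∀ i, ContDiff ℝ ∞ (g i)) ∧
      ∀ x y, f x = f y + ∑ i, (x i - y i) * g i (x, y) := by
  have hdf : ContDiff ℝ ∞ (fderiv ℝ f) := hf.fderiv_right (by simp)
  have hF : ∀ i : Fin n, ContDiff ℝ ∞ (fun p : ((Fin n → ℝ) × (Fin n → ℝ)) × ℝ =>
      fderiv ℝ f (p.1.2 + p.2 • (p.1.1 - p.1.2)) (Pi.single i 1)) := by
    intro i
    exact (hdf.comp (by fun_prop)).clm_apply contDiff_const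
  refine ⟨fun i q => ∫ t in (0 : ℝ)..1, fderiv ℝ f (q.2 + t • (q.1 - q.2)) (Pi.single i 1),
    fun i => contDiff_infty.2 fun k => contDiff_intervalIntegral k _ (hF i), fun x y => ?_⟩
  have hder : ∀ t : ℝ, HasDerivAt (fun t : ℝ => f (y + t • (x - y)))
      (fderiv ℝ f (y + t • (x - y)) (x - y)) t := by
    intro t
    have h1 : HasDerivAt (fun t : ℝ => y + t • (x - y)) (x - y) t := by
      simpa using ((hasDerivAt_id t).smul_const (x - y)).const_add y
    exact ((hf.differentiable (by simp)) _).hasFDerivAt.comp_hasDerivAt t h1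
  have hcont : ∀ v, Continuous fun t : ℝ => fderiv ℝ f (y + t • (x - y)) v := fun v =>
    (hdf.continuous.comp (by fun_prop)).clm_apply continuous_const
  have hint := intervalIntegral.integral_eq_sub_of_hasDerivAt (a := 0) (b := 1)
    (fun t _ => hder t) ((hcont _).intervalIntegrable _ _)
  have hsum : ∀ t : ℝ, fderiv ℝ f (y + t • (x - y)) (x - y) =
      ∑ i, (x i - y i) * fderiv ℝ f (y + t • (x - y)) (Pi.single i 1) := by
    intro t
    have e := congrArg (fderiv ℝ f (y + t • (x - y))) (pi_eq_sum_univ' (x - y))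
    rw [map_sum] at e
    rw [e]
    refine Finset.sum_congr rfl fun i _ => ?_
    rw [map_smul, smul_eq_mul, Pi.sub_apply]
  simp only [hsum] at hint
  rw [intervalIntegral.integral_finsetSum
    (fun i _ => ((hcont _).const_mul _).intervalIntegrable _ _)] at hint
  simp only [intervalIntegral.integral_const_mul] at hint
  rw [hint]
  simp

variable {A : Type u} [CInftyRing A]

/-- An ideal of the underlying ring is a congruence for all smooth operations. -/
theorem op_sub_op_mem (I : Ideal A) {n : ℕ} (f : (Fin n → ℝ) → ℝ) (hf : ContDiff ℝ ∞ f)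
    (a b : Fin n → A) (h : ∀ i, a i - b i ∈ I) : op f hf a - op f hf b ∈ I := by
  obtain ⟨g, hg, hfg⟩ := hadamard f hf
  set c : Fin (n + n) → A := Fin.append a b with hc
  have hl : ∀ i : Fin n, ContDiff ℝ ∞ fun z : Fin (n + n) → ℝ => z (Fin.castAdd n i) :=
    fun i => contDiff_apply ℝ ℝ _
  have hr : ∀ i : Fin n, ContDiff ℝ ∞ fun z : Fin (n + n) → ℝ => z (Fin.natAdd n i) :=
    fun i => contDiff_apply ℝ ℝ _
  have hG : ∀ i, ContDiff ℝ ∞ fun z : Fin (n + n) → ℝ =>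
      g i (fun j => z (Fin.castAdd n j), fun j => z (Fin.natAdd n j)) := fun i =>
    (hg i).comp ((contDiff_pi.2 hl).prodMk (contDiff_pi.2 hr))
  have ha : op f hf a = op (fun z : Fin (n + n) → ℝ => f fun i => z (Fin.castAdd n i))
      (hf.comp (contDiff_pi.2 hl)) c := by
    rw [← op_reindex f hf (fun i => Fin.castAdd n i) c]; simp only [hc, Fin.append_left]
  have hb : op f hf b = op (fun z : Fin (n + n) → ℝ => f fun i => z (Fin.natAdd n i))
      (hf.comp (contDiff_pi.2 hr)) c := by
    rw [← op_reindex f hf (fun i => Fin.natAdd n i) c]; simp only [hc, Fin.append_right]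
  have hsub : ∀ i : Fin n, ContDiff ℝ ∞ fun z : Fin (n + n) → ℝ =>
      z (Fin.castAdd n i) - z (Fin.natAdd n i) := fun i => (hl i).sub (hr i)
  have hsubmem : ∀ i, op _ (hsub i) c ∈ I := by
    intro i
    have e := op_fun_add (A := A) (hsub i) (hr i) c
    rw [op_congr _ (hl i) (by funext z; simp), op_proj, op_proj] at e
    have e' : op _ (hsub i) c = a i - b i := by
      rw [hc, Fin.append_left, Fin.append_right] at e; rw [eq_sub_iff_add_eq, hc, ← e]
    rw [e']; exact h i
  have key : op f hf a = op f hf b + ∑ i, op _ (hsub i) c * op _ (hG i) c := by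
    rw [ha, hb]
    simp only [← op_fun_mul]
    rw [← op_fun_sum _ _ (fun i => (hsub i).mul (hG i)), ← op_fun_add]
    exact op_congr _ _ (by funext z; exact hfg _ _) c
  rw [key, add_sub_cancel_left]
  exact Ideal.sum_mem _ fun i _ => Ideal.mul_mem_right _ _ (hsubmem i)

/-- The smooth operations on `A ⧸ I`, given by those of `A` on representatives. -/
noncomputable def quotOp (I : Ideal A) {n : ℕ} (f : (Fin n → ℝ) → ℝ) (hf : ContDiff ℝ ∞ f)
    (a : Fin n → A ⧸ I) : A ⧸ I :=
  Ideal.Quotient.mk I (op f hf fun i => (a i).out)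

theorem quotOp_mk (I : Ideal A) {n : ℕ} (f : (Fin n → ℝ) → ℝ) (hf : ContDiff ℝ ∞ f)
    (a : Fin n → A) :
    quotOp I f hf (fun i => Ideal.Quotient.mk I (a i)) = Ideal.Quotient.mk I (op f hf a) := by
  refine Ideal.Quotient.eq.2 (op_sub_op_mem I f hf _ _ fun i => Ideal.Quotient.eq.1 ?_)
  exact Quotient.out_eq _

theorem exists_rep (I : Ideal A) {n : ℕ} (a : Fin n → A ⧸ I) :
    ∃ b : Fin n → A, a = fun i => Ideal.Quotient.mk I (b i) :=
  ⟨fun i => (a i).out, funext fun _ => (Quotient.out_eq _).symm⟩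

/-- The quotient `C^∞`-ring `A ⧸ I`. -/
noncomputable instance instQuotient (I : Ideal A) : CInftyRing (A ⧸ I) where
  toCommRing := Ideal.Quotient.commRing I
  op := quotOp I
  op_proj i a := by
    obtain ⟨b, rfl⟩ := exists_rep I a
    rw [quotOp_mk, op_proj]
  op_comp f hf g hg a := by
    obtain ⟨b, rfl⟩ := exists_rep I a
    simp only [quotOp_mk, op_comp]
  op_add a := by
    obtain ⟨b, rfl⟩ := exists_rep I a
    rw [quotOp_mk, op_add, map_add]
  op_mul a := by
    obtain ⟨b, rfl⟩ := exists_rep I a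
    rw [quotOp_mk, op_mul, map_mul]

end CInftyRing

namespace CInftyHom

variable {A : Type u} {B : Type v} [CInftyRing A] [CInftyRing B]

/-- The projection `A → A ⧸ I`. -/
noncomputable def quotMk (I : Ideal A) : CInftyHom A (A ⧸ I) where
  toFun := Ideal.Quotient.mk I
  map_op f hf a := (CInftyRing.quotOp_mk I f hf a).symm

/-- The morphism `A ⧸ I → B` induced by a morphism `A → B` that vanishes on `I`. -/
noncomputable def quotLift (I : Ideal A) (φ : CInftyHom A B) (h : ∀ a ∈ I, φ a = 0) :
    CInftyHom (A ⧸ I) B where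
  toFun := Ideal.Quotient.lift I φ.toRingHom h
  map_op f hf a := by
    obtain ⟨b, rfl⟩ := CInftyRing.exists_rep I a
    exact (congrArg _ (CInftyRing.quotOp_mk I f hf b)).trans (φ.map_op f hf b)

end CInftyHom

/-! ## Rings of smooth functions on manifolds -/

namespace CInftyRing

variable {E : Type*} [NormedAddCommGroup E] [NormedSpace ℝ E] {H : Type*} [TopologicalSpace H]
  {J : ModelWithCorners ℝ E H} {M : Type*} [TopologicalSpace M] [ChartedSpace H M]
  {E' : Type*} [NormedAddCommGroup E'] [NormedSpace ℝ E'] {H' : Type*} [TopologicalSpace H']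
  {J' : ModelWithCorners ℝ E' H'} {M' : Type*} [TopologicalSpace M'] [ChartedSpace H' M']

/-- `C^∞(M)`, with `f(g₁, …, gₙ) = f ∘ (g₁, …, gₙ)`. -/
noncomputable instance instSmoothFunctions : CInftyRing C^∞⟮J, M; 𝓘(ℝ, ℝ), ℝ⟯ where
  toCommRing := inferInstance
  op f hf g := ⟨fun p => f fun i => g i p,
    hf.comp_contMDiff (contMDiff_pi_space.2 fun i => (g i).contMDiff)⟩
  op_proj _ _ := rfl
  op_comp _ _ _ _ _ := rfl
  op_add _ := rfl
  op_mul _ := rfl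

/-- The morphism `C^∞(M') → C^∞(M)`, `h ↦ h ∘ φ`, for a smooth map `φ : M → M'`. -/
noncomputable def pullback (φ : C^∞⟮J, M; J', M'⟯) :
    CInftyHom C^∞⟮J', M'; 𝓘(ℝ, ℝ), ℝ⟯ C^∞⟮J, M; 𝓘(ℝ, ℝ), ℝ⟯ where
  toFun h := h.comp φ
  map_op _ _ _ := rfl

end CInftyRing

/-- The open submanifold `ℝ ∖ {0}` of `ℝ`. -/
def puncturedLine : TopologicalSpace.Opens ℝ := ⟨{0}ᶜ, isOpen_compl_singleton⟩

/-- The `C^∞`-ring `C^∞(ℝ)`. -/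
abbrev SmoothLine : Type := C^∞⟮𝓘(ℝ, ℝ), ℝ; 𝓘(ℝ, ℝ), ℝ⟯

/-- The `C^∞`-ring `C^∞(ℝ ∖ {0})`. -/
abbrev SmoothPuncturedLine : Type := C^∞⟮𝓘(ℝ, ℝ), puncturedLine; 𝓘(ℝ, ℝ), ℝ⟯

namespace SmoothLine

/-- The coordinate `x`, the free generator of `C^∞(ℝ)`. -/
noncomputable def X : SmoothLine := ContMDiffMap.id

/-- Restriction of functions, `C^∞(ℝ) → C^∞(ℝ ∖ {0})`. -/
noncomputable def restrict : CInftyHom SmoothLine SmoothPuncturedLine :=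
  CInftyRing.pullback ⟨Subtype.val, contMDiff_subtype_val⟩

/-- The morphism `C^∞(ℝ) → A` with `x ↦ g`, that is `h ↦ h(g)`. -/
noncomputable def evalAt {A : Type u} [CInftyRing A] (g : A) : CInftyHom SmoothLine A where
  toFun h := CInftyRing.op (fun x : Fin 1 → ℝ => h (x 0))
    ((contMDiff_iff_contDiff.1 h.contMDiff).comp (contDiff_apply ℝ ℝ 0)) (fun _ => g)
  map_op f hf _ := (CInftyRing.op_comp f hf _ _ _).symm

theorem evalAt_X {A : Type u} [CInftyRing A] (g : A) : evalAt g X = g :=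
  CInftyRing.op_proj (0 : Fin 1) fun _ => g

/-- A morphism out of `C^∞(ℝ)` is determined by the image of `x`. -/
theorem hom_ext {A : Type u} [CInftyRing A] {φ ψ : CInftyHom SmoothLine A} (h : φ X = ψ X) :
    φ = ψ := by
  refine CInftyHom.ext' fun f => ?_
  have e : f = CInftyRing.op (fun x : Fin 1 → ℝ => f (x 0))
      ((contMDiff_iff_contDiff.1 f.contMDiff).comp (contDiff_apply ℝ ℝ 0)) (fun _ => X) := rfl
  rw [e, φ.map_op, ψ.map_op, h]

end SmoothLine

/-! ## Free `C^∞`-rings and coproducts -/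

/-- The functions `ℝ^S → ℝ` that factor as a projection `ℝ^S → ℝⁿ` to finitely many coordinates
followed by a smooth function `ℝⁿ → ℝ`. -/
def IsFinitelySmooth {S : Type u} (F : (S → ℝ) → ℝ) : Prop :=
  ∃ (n : ℕ) (s : Fin n → S) (f : (Fin n → ℝ) → ℝ),
    ContDiff ℝ ∞ f ∧ F = fun x => f fun i => x (s i)

theorem IsFinitelySmooth.op {S : Type u} {n : ℕ} {f : (Fin n → ℝ) → ℝ} (hf : ContDiff ℝ ∞ f)
    {F : Fin n → (S → ℝ) → ℝ} (hF : ∀ i, IsFinitelySmooth (F i)) :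
    IsFinitelySmooth fun x => f fun i => F i x := by
  choose m s g hg hFg using hF
  let e := Fintype.equivFin (Σ i, Fin (m i))
  have hs : ∀ i j, s (e.symm (e ⟨i, j⟩)).1 (e.symm (e ⟨i, j⟩)).2 = s i j := fun i j =>
    congrArg (fun p : Σ i, Fin (m i) => s p.1 p.2) (e.symm_apply_apply ⟨i, j⟩)
  refine ⟨_, fun k => s (e.symm k).1 (e.symm k).2,
    fun z => f fun i => g i fun j => z (e ⟨i, j⟩), ?_, ?_⟩
  · exact hf.comp (contDiff_pi.2 fun i => (hg i).comp (contDiff_pi.2 fun j => contDiff_apply ℝ ℝ _))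
  · funext x
    refine congrArg f (funext fun i => ?_)
    rw [hFg i]
    refine congrArg (g i) (funext fun j => ?_)
    exact congrArg x (hs i j).symm

/-- The underlying ring of the free `C^∞`-ring `C^∞(ℝ^S)` on a set `S`. -/
def freeSubring (S : Type u) : Subring ((S → ℝ) → ℝ) where
  carrier := {F | IsFinitelySmooth F}
  zero_mem' := ⟨0, fun i => i.elim0, fun _ => 0, contDiff_const, rfl⟩
  one_mem' := ⟨0, fun i => i.elim0, fun _ => 1, contDiff_const, rfl⟩
  add_mem' {F G} hF hG := by
    have h := IsFinitelySmooth.op (n := 2)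
      ((contDiff_apply ℝ ℝ (0 : Fin 2)).add (contDiff_apply ℝ ℝ 1)) (F := ![F, G])
      (fun i => by fin_cases i <;> assumption)
    exact h
  mul_mem' {F G} hF hG := by
    have h := IsFinitelySmooth.op (n := 2)
      ((contDiff_apply ℝ ℝ (0 : Fin 2)).mul (contDiff_apply ℝ ℝ 1)) (F := ![F, G])
      (fun i => by fin_cases i <;> assumption)
    exact h
  neg_mem' {F} hF := by
    have h := IsFinitelySmooth.op (n := 1) (contDiff_apply ℝ ℝ (0 : Fin 1)).neg (F := ![F])
      (fun i => by fin_cases i; assumption)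
    exact h

/-- The free `C^∞`-ring `C^∞(ℝ^S)`. -/
abbrev FreeCInfty (S : Type u) : Type u := freeSubring S

namespace FreeCInfty

variable {S : Type u} {A : Type v} [CInftyRing A]

instance instCInftyRing : CInftyRing (FreeCInfty S) where
  toCommRing := inferInstance
  op f hf F := ⟨fun x => f fun i => (F i).1 x, IsFinitelySmooth.op hf fun i => (F i).2⟩
  op_proj _ _ := rfl
  op_comp _ _ _ _ _ := rfl
  op_add _ := rfl
  op_mul _ := rfl

/-- The coordinate functions, the free generators of `C^∞(ℝ^S)`. -/
def X (s : S) : FreeCInfty S :=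
  ⟨fun x => x s, 1, fun _ => s, fun z => z 0, contDiff_apply ℝ ℝ 0, rfl⟩

theorem op_eq_op (φ : S → A) {n m : ℕ} (s : Fin n → S) (t : Fin m → S)
    (f : (Fin n → ℝ) → ℝ) (hf : ContDiff ℝ ∞ f) (g : (Fin m → ℝ) → ℝ) (hg : ContDiff ℝ ∞ g)
    (h : (fun x : S → ℝ => f fun i => x (s i)) = fun x => g fun i => x (t i)) :
    CInftyRing.op f hf (fun i => φ (s i)) = CInftyRing.op g hg (fun i => φ (t i)) := by
  classical
  let T : Finset S := Finset.univ.image s ∪ Finset.univ.image t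
  let e := T.equivFin
  have hs : ∀ i, s i ∈ T := fun i => by simp [T]
  have ht : ∀ i, t i ∈ T := fun i => by simp [T]
  have h1 := CInftyRing.op_reindex (A := A) f hf (fun i => e ⟨s i, hs i⟩)
    (fun k => φ (e.symm k).1)
  have h2 := CInftyRing.op_reindex (A := A) g hg (fun i => e ⟨t i, ht i⟩)
    (fun k => φ (e.symm k).1)
  simp only [Equiv.symm_apply_apply] at h1 h2
  rw [h1, h2]
  refine CInftyRing.op_congr _ _ (funext fun z => ?_) _
  have h3 := congrFun h (fun a => if ha : a ∈ T then z (e ⟨a, ha⟩) else 0)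
  simpa [hs, ht] using h3

/-- The value `F(φ)` in `A` of `F ∈ C^∞(ℝ^S)` at a family `φ` of elements of `A`. -/
noncomputable def liftFun (φ : S → A) (F : FreeCInfty S) : A :=
  CInftyRing.op F.2.choose_spec.choose_spec.choose
    F.2.choose_spec.choose_spec.choose_spec.1 (fun i => φ (F.2.choose_spec.choose i))

theorem liftFun_eq (φ : S → A) (F : FreeCInfty S) {n : ℕ} (s : Fin n → S)
    (f : (Fin n → ℝ) → ℝ) (hf : ContDiff ℝ ∞ f) (h : F.1 = fun x => f fun i => x (s i)) :
    liftFun φ F = CInftyRing.op f hf (fun i => φ (s i)) :=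
  op_eq_op φ _ s _ _ f hf (F.2.choose_spec.choose_spec.choose_spec.2.symm.trans h)

/-- The morphism `C^∞(ℝ^S) → A` determined by the images of the generators. -/
noncomputable def lift (φ : S → A) : CInftyHom (FreeCInfty S) A where
  toFun := liftFun φ
  map_op {n} f hf F := by
    choose m s g hg hFg using fun i => (F i).2
    let e := Fintype.equivFin (Σ i, Fin (m i))
    have hs : ∀ i j, s (e.symm (e ⟨i, j⟩)).1 (e.symm (e ⟨i, j⟩)).2 = s i j := fun i j =>
      congrArg (fun p : Σ i, Fin (m i) => s p.1 p.2) (e.symm_apply_apply ⟨i, j⟩)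
    have hG : ∀ i, ContDiff ℝ ∞ fun z : Fin (Fintype.card (Σ i, Fin (m i))) → ℝ =>
        g i fun j => z (e ⟨i, j⟩) :=
      fun i => (hg i).comp (contDiff_pi.2 fun j => contDiff_apply ℝ ℝ _)
    have h1 : ∀ i, liftFun φ (F i) = CInftyRing.op _ (hG i)
        (fun k => φ (s (e.symm k).1 (e.symm k).2)) := by
      intro i
      refine liftFun_eq φ (F i) (fun k => s (e.symm k).1 (e.symm k).2) _ (hG i) ?_
      simp only [hs]
      exact hFg i
    simp only [h1]
    rw [CInftyRing.op_comp f hf _ hG]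
    refine liftFun_eq φ _ (fun k => s (e.symm k).1 (e.symm k).2) _ _ ?_
    simp only [hs]
    funext x
    exact congrArg f (funext fun i => congrFun (hFg i) x)

theorem lift_X (φ : S → A) (s : S) : lift φ (X s) = φ s :=
  (liftFun_eq φ (X s) (fun _ : Fin 1 => s) (fun z => z 0) (contDiff_apply ℝ ℝ 0) rfl).trans
    (CInftyRing.op_proj (0 : Fin 1) fun _ => φ s)

/-- A morphism out of `C^∞(ℝ^S)` is determined by the images of the generators. -/
theorem hom_ext {ψ χ : CInftyHom (FreeCInfty S) A} (h : ∀ s, ψ (X s) = χ (X s)) : ψ = χ := by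
  refine CInftyHom.ext' fun F => ?_
  obtain ⟨n, s, f, hf, hF⟩ := F.2
  have e : F = CInftyRing.op f hf fun i => X (s i) := Subtype.ext hF
  rw [e, ψ.map_op, χ.map_op]
  simp only [h]

end FreeCInfty

namespace CInftyRing

variable (A : Type u) (B : Type v) [CInftyRing A] [CInftyRing B]

/-- The relations that make the two maps of generators `A → C^∞(ℝ^(A ⊔ B)) ← B` commute with all
smooth operations. -/
def coprodIdeal : Ideal (FreeCInfty (A ⊕ B)) :=
  Ideal.span
    ({r | ∃ (n : ℕ) (f : (Fin n → ℝ) → ℝ) (hf : ContDiff ℝ ∞ f) (a : Fin n → A),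
        r = FreeCInfty.X (Sum.inl (op f hf a)) -
          op f hf (fun i => FreeCInfty.X (Sum.inl (a i)))} ∪
      {r | ∃ (n : ℕ) (f : (Fin n → ℝ) → ℝ) (hf : ContDiff ℝ ∞ f) (b : Fin n → B),
        r = FreeCInfty.X (Sum.inr (op f hf b)) -
          op f hf (fun i => FreeCInfty.X (Sum.inr (b i)))})

/-- The coproduct of two `C^∞`-rings, presented by the generators `A ⊔ B`. -/
def Coprod : Type (max u v) := FreeCInfty (A ⊕ B) ⧸ coprodIdeal A B

noncomputable instance instCoprod : CInftyRing (Coprod A B) := instQuotient (coprodIdeal A B)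

namespace Coprod

variable {C : Type w} [CInftyRing C]

/-- The first coprojection. -/
noncomputable def inl : CInftyHom A (Coprod A B) where
  toFun a := CInftyHom.quotMk (coprodIdeal A B) (FreeCInfty.X (Sum.inl a))
  map_op f hf a := by
    refine Eq.trans ?_ ((CInftyHom.quotMk (coprodIdeal A B)).map_op f hf _)
    exact Ideal.Quotient.eq.2 (Ideal.subset_span (Or.inl ⟨_, f, hf, a, rfl⟩))

/-- The second coprojection. -/
noncomputable def inr : CInftyHom B (Coprod A B) where
  toFun b := CInftyHom.quotMk (coprodIdeal A B) (FreeCInfty.X (Sum.inr b))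
  map_op f hf b := by
    refine Eq.trans ?_ ((CInftyHom.quotMk (coprodIdeal A B)).map_op f hf _)
    exact Ideal.Quotient.eq.2 (Ideal.subset_span (Or.inr ⟨_, f, hf, b, rfl⟩))

variable {A B}

theorem lift_eq_zero (φ : CInftyHom A C) (ψ : CInftyHom B C) :
    ∀ r ∈ coprodIdeal A B, FreeCInfty.lift (Sum.elim φ ψ) r = 0 := by
  suffices h : coprodIdeal A B ≤
      RingHom.ker (FreeCInfty.lift (Sum.elim φ ψ)).toRingHom from fun r hr => h hr
  refine Ideal.span_le.2 ?_
  rintro r (⟨n, f, hf, a, rfl⟩ | ⟨n, f, hf, a, rfl⟩)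
  all_goals
    refine (RingHom.mem_ker).2 ?_
    rw [map_sub, sub_eq_zero]
    refine (FreeCInfty.lift_X _ _).trans ?_
    refine Eq.trans ?_ ((FreeCInfty.lift (Sum.elim φ ψ)).map_op f hf _).symm
    simp only [FreeCInfty.lift_X, Sum.elim_inl, Sum.elim_inr, CInftyHom.map_op]

/-- The morphism out of a coproduct given by morphisms out of both summands. -/
noncomputable def desc (φ : CInftyHom A C) (ψ : CInftyHom B C) : CInftyHom (Coprod A B) C :=
  CInftyHom.quotLift (coprodIdeal A B) (FreeCInfty.lift (Sum.elim φ ψ)) (lift_eq_zero φ ψ)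

theorem desc_inl (φ : CInftyHom A C) (ψ : CInftyHom B C) (a : A) :
    desc φ ψ (inl A B a) = φ a :=
  FreeCInfty.lift_X (Sum.elim φ ψ) (Sum.inl a)

theorem desc_inr (φ : CInftyHom A C) (ψ : CInftyHom B C) (b : B) :
    desc φ ψ (inr A B b) = ψ b :=
  FreeCInfty.lift_X (Sum.elim φ ψ) (Sum.inr b)

/-- A morphism out of a coproduct is determined by its restrictions to both summands. -/
theorem hom_ext {χ χ' : CInftyHom (Coprod A B) C} (hl : ∀ a, χ (inl A B a) = χ' (inl A B a))
    (hr : ∀ b, χ (inr A B b) = χ' (inr A B b)) : χ = χ' := by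
  have h : χ.comp (CInftyHom.quotMk (coprodIdeal A B)) =
      χ'.comp (CInftyHom.quotMk (coprodIdeal A B)) :=
    FreeCInfty.hom_ext fun s => by
      cases s with
      | inl a => exact hl a
      | inr b => exact hr b
  refine CInftyHom.ext' fun c => ?_
  obtain ⟨F, rfl⟩ := Ideal.Quotient.mk_surjective c
  exact congrArg (fun θ : CInftyHom (FreeCInfty (A ⊕ B)) C => θ F) h

variable (A) in
/-- The morphism `id ⊗ ψ` of coproducts. -/
noncomputable def mapRight (ψ : CInftyHom B C) : CInftyHom (Coprod A B) (Coprod A C) :=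
  desc (inl A C) ((inr A C).comp ψ)

end Coprod

/-! ## Localization, the `∞`-radical and `∞`-nilpotent elements -/

variable {A}

/-- The ideal of `A ⊗ C^∞(ℝ)` generated by `a x - 1`. -/
noncomputable def invertIdeal (a : A) : Ideal (Coprod A SmoothLine) :=
  Ideal.span {Coprod.inl A SmoothLine a * Coprod.inr A SmoothLine SmoothLine.X - 1}

/-- The `C^∞`-ring `A{a⁻¹}` obtained from `A` by inverting `a`: a variable `x` is adjoined freely
and `a x = 1` is imposed. -/
def Invert (a : A) : Type u := Coprod A SmoothLine ⧸ invertIdeal a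

noncomputable instance instInvert (a : A) : CInftyRing (Invert a) := instQuotient (invertIdeal a)

/-- The universal property of `A{a⁻¹}`: the morphism `A → A{a⁻¹}` makes `a` invertible, and a
morphism `A → B` that makes `a` invertible factors uniquely through it. -/
theorem invert_universal (a : A) {B : Type v} [CInftyRing B] :
    let ι : CInftyHom A (Invert a) := (CInftyHom.quotMk (invertIdeal a)).comp (Coprod.inl A SmoothLine)
    IsUnit (ι a) ∧ ∀ φ : CInftyHom A B, IsUnit (φ a) → ∃! ψ : CInftyHom (Invert a) B, ψ.comp ι = φ := by
  have hrel : CInftyHom.quotMk (invertIdeal a) (Coprod.inl A SmoothLine a) *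
      CInftyHom.quotMk (invertIdeal a) (Coprod.inr A SmoothLine SmoothLine.X) = 1 := by
    have h : Ideal.Quotient.mk (invertIdeal a)
        (Coprod.inl A SmoothLine a * Coprod.inr A SmoothLine SmoothLine.X) =
          Ideal.Quotient.mk (invertIdeal a) 1 :=
      Ideal.Quotient.eq.2 (Ideal.subset_span rfl)
    rwa [map_mul, map_one] at h
  refine ⟨IsUnit.of_mul_eq_one _ hrel, fun φ hφ => ?_⟩
  obtain ⟨u, hu⟩ := hφ
  let d : CInftyHom (Coprod A SmoothLine) B := Coprod.desc φ (SmoothLine.evalAt (↑u⁻¹ : B))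
  have hd : invertIdeal a ≤ RingHom.ker d.toRingHom := by
    refine Ideal.span_le.2 ?_
    rintro _ rfl
    refine RingHom.mem_ker.2 ?_
    rw [map_sub, map_mul, map_one, sub_eq_zero]
    have e1 : d.toRingHom (Coprod.inl A SmoothLine a) = u :=
      (Coprod.desc_inl φ _ a).trans hu.symm
    have e2 : d.toRingHom (Coprod.inr A SmoothLine SmoothLine.X) = (↑u⁻¹ : B) :=
      (Coprod.desc_inr φ _ _).trans (SmoothLine.evalAt_X _)
    rw [e1, e2, Units.mul_inv]
  refine ⟨CInftyHom.quotLift (invertIdeal a) d fun r hr => hd hr,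
    CInftyHom.ext' fun b => Coprod.desc_inl φ _ b, fun ψ hψ => ?_⟩
  have hψd : ψ.comp (CInftyHom.quotMk (invertIdeal a)) = d := by
    refine Coprod.hom_ext (fun b => ?_) fun h => ?_
    · exact (congrArg (fun θ : CInftyHom A B => θ b) hψ).trans (Coprod.desc_inl φ _ b).symm
    · refine congrArg (fun θ : CInftyHom SmoothLine B => θ h) (SmoothLine.hom_ext
        (φ := (ψ.comp (CInftyHom.quotMk (invertIdeal a))).comp (Coprod.inr A SmoothLine))
        (ψ := d.comp (Coprod.inr A SmoothLine)) ?_)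
      have e2 : d (Coprod.inr A SmoothLine SmoothLine.X) = (↑u⁻¹ : B) :=
        (Coprod.desc_inr φ _ _).trans (SmoothLine.evalAt_X _)
      have e3 := ((ψ.toRingHom.map_mul _ _).symm.trans (congrArg ψ.toRingHom hrel)).trans
        ψ.toRingHom.map_one
      have e4 : ψ.toRingHom (CInftyHom.quotMk (invertIdeal a) (Coprod.inl A SmoothLine a)) = u :=
        (congrArg (fun θ : CInftyHom A B => θ a) hψ).trans hu.symm
      rw [e4] at e3
      exact (Units.eq_inv_of_mul_eq_one_left e3).trans e2.symm
  refine CInftyHom.ext' fun c => ?_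
  obtain ⟨F, rfl⟩ := Ideal.Quotient.mk_surjective c
  exact congrArg (fun θ : CInftyHom (Coprod A SmoothLine) B => θ F) hψd

/-- The `∞`-radical of an ideal `I`: the elements `g` of `A` with `(A ⧸ I){g⁻¹} = 0`. -/
def infRadical (I : Ideal A) : Set A :=
  {g | Subsingleton (Invert (Ideal.Quotient.mk I g))}

/-- The value `f(g)` in `A` of `f ∈ A ⊗ C^∞(ℝ)` at `g ∈ A`: the morphism `A ⊗ C^∞(ℝ) → A` that is
the identity on `A` and sends `x` to `g`. -/
noncomputable def substitute (g : A) : CInftyHom (Coprod A SmoothLine) A :=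
  Coprod.desc (CInftyHom.id A) (SmoothLine.evalAt g)

/-- An element `g` of `A` is `∞`-nilpotent if there is `f ∈ A ⊗ C^∞(ℝ)` with `f(g) = 0` whose image
in `A ⊗ C^∞(ℝ ∖ {0})` is invertible. -/
def IsInfNilpotent (g : A) : Prop :=
  ∃ f : Coprod A SmoothLine,
    substitute g f = 0 ∧ IsUnit (Coprod.mapRight A SmoothLine.restrict f)

end CInftyRing

/-! Put `B = A ⧸ I`. Membership in the radical says by definition that `B{g⁻¹} = 0`, so the claim
concerns one element `g` of one `C^∞`-ring `B`, and no finiteness of `B` enters.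

If `B{g⁻¹} = 0`, then `1 = q(x) (g x - 1)` in `B ⊗ C^∞(ℝ)` for some `q`. Over `ℝ ∖ {0}` one may
substitute `1/x` for `x`, which gives `1 = q(1/x) (1/x) (g - x)`. Thus `f = g - x`, which vanishes
at `g`, becomes invertible: `isInfNilpotent_of_subsingleton_invert`.

Conversely, let `ι : B → B{g⁻¹}` be the canonical morphism. As `ι g` is invertible, `f ↦ ι (f(g))`
factors through `B ⊗ C^∞(ℝ ∖ {0})` (`exists_comp_mapRight_restrict`). A witness `f` then has an
image that is both a unit and zero, so `B{g⁻¹} = 0`.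

The analytic content is that factorization: smooth functions on `ℝ ∖ {0}` must be evaluated at an
invertible `u` of an arbitrary `C^∞`-ring, whose operations only accept functions on all of `ℝⁿ`.
Identify `ℝ ∖ {0}` with the hyperbola `x y = 1`, extend functions to the plane by a cut-off, and
evaluate at `(u, u⁻¹)`. The choice of extension is immaterial by `op_eq_zero_of_hyperbola`, a
consequence of Hadamard's lemma. -/

namespace CInftyRing

/-! ### Smooth functions on the plane and the hyperbola `x y = 1` -/

/-- A smooth cut-off function that vanishes for `t ≤ 1 / 2` and equals `1` at `1`. -/
noncomputable def cutoff (t : ℝ) : ℝ := Real.smoothTransition (2 * t - 1)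

theorem contDiff_cutoff : ContDiff ℝ ∞ cutoff :=
  Real.smoothTransition.contDiff.comp (by fun_prop)

theorem cutoff_of_le {t : ℝ} (h : t ≤ 1 / 2) : cutoff t = 0 :=
  Real.smoothTransition.zero_of_nonpos (by linarith)

theorem cutoff_one : cutoff 1 = 1 :=
  Real.smoothTransition.one_of_one_le (by norm_num)

theorem contDiff_cutoff_mul_apply :
    ContDiff ℝ ∞ fun z : Fin 2 → ℝ => cutoff (z 0 * z 1) :=
  contDiff_cutoff.comp (by fun_prop)

/-- A function that is smooth off the line `x = 0` becomes smooth on the plane after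
multiplication with `cutoff (x y)`. -/
theorem contDiff_cutoff_mul {G : (Fin 2 → ℝ) → ℝ} (hG : ∀ z, z 0 ≠ 0 → ContDiffAt ℝ ∞ G z) :
    ContDiff ℝ ∞ fun z : Fin 2 → ℝ => cutoff (z 0 * z 1) * G z := by
  refine contDiff_iff_contDiffAt.2 fun z => ?_
  by_cases hz : z 0 = 0
  · have hc : Continuous fun z : Fin 2 → ℝ => z 0 * z 1 := by fun_prop
    -- Near a point of the line `x = 0` the product `x y` stays below `1 / 2`, so the cut-off kills
    -- `G` on a whole neighbourhood, however singular `G` is there.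
    have hev : ∀ᶠ w in nhds z, w 0 * w 1 < 1 / 2 :=
      hc.continuousAt.eventually_lt_const (by simp [hz])
    refine (contDiffAt_const (c := (0 : ℝ))).congr_of_eventuallyEq ?_
    filter_upwards [hev] with w hw
    rw [cutoff_of_le hw.le, zero_mul]
  · exact contDiff_cutoff_mul_apply.contDiffAt.mul (hG z hz)

variable {C : Type u} [CInftyRing C]

/-- The cut-off depends on `x y` alone, and `u v = 1` is also the value of the constant function
`1`; composing gives the constant `cutoff 1 = 1`. Hence multiplying by the cut-off is harmless at
`(u, v)`. -/
theorem op_cutoff {u v : C} (huv : u * v = 1) :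
    op (fun z : Fin 2 → ℝ => cutoff (z 0 * z 1)) contDiff_cutoff_mul_apply ![u, v] = 1 := by
  have hc : ContDiff ℝ ∞ fun x : Fin 1 → ℝ => cutoff (x 0) :=
    contDiff_cutoff.comp (contDiff_apply ℝ ℝ 0)
  have h1 := op_comp _ hc (fun _ (z : Fin 2 → ℝ) => z 0 * z 1)
    (fun _ => (contDiff_apply ℝ ℝ 0).mul (contDiff_apply ℝ ℝ 1)) ![u, v]
  have h2 := op_comp _ hc (fun _ (_ : Fin 2 → ℝ) => (1 : ℝ)) (fun _ => contDiff_const) ![u, v]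
  have e : op (fun z : Fin 2 → ℝ => z 0 * z 1)
      ((contDiff_apply ℝ ℝ 0).mul (contDiff_apply ℝ ℝ 1)) ![u, v] =
        op (fun _ : Fin 2 → ℝ => (1 : ℝ)) contDiff_const ![u, v] := by
    rw [op_mul, op_fun_one]
    exact huv
  rw [e] at h1
  refine (h1.symm.trans h2).trans ?_
  rw [op_congr _ (contDiff_const (c := (1 : ℝ))) (funext fun _ => cutoff_one), op_fun_one]

/-- A smooth function on the plane that vanishes on the hyperbola `x y = 1` vanishes at each pair
of mutually inverse elements. -/
theorem op_eq_zero_of_hyperbola {F : (Fin 2 → ℝ) → ℝ} (hF : ContDiff ℝ ∞ F)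
    (h : ∀ x : ℝ, x ≠ 0 → F ![x, x⁻¹] = 0) {u v : C} (huv : u * v = 1) :
    op F hF ![u, v] = 0 := by
  obtain ⟨g, hg, hFg⟩ := hadamard F hF
  -- Comparing `(x, y)` with the point `(x, 1/x)` of the hyperbola, Hadamard's lemma leaves only the
  -- term `(y - 1/x) g₁`, that is `F = (x y - 1) G` for `x ≠ 0`.
  set G : (Fin 2 → ℝ) → ℝ := fun z => (z 0)⁻¹ * g 1 (z, ![z 0, (z 0)⁻¹]) with hGdef
  have hG : ∀ z, z 0 ≠ 0 → ContDiffAt ℝ ∞ G z := by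
    intro z hz
    have hi : ContDiffAt ℝ ∞ (fun z : Fin 2 → ℝ => (z 0)⁻¹) z :=
      (contDiff_apply ℝ ℝ (0 : Fin 2)).contDiffAt.inv hz
    refine hi.mul ((hg 1).contDiffAt.comp z (contDiffAt_id.prodMk (contDiffAt_pi.2 fun i => ?_)))
    fin_cases i
    · exact (contDiff_apply ℝ ℝ (0 : Fin 2)).contDiffAt
    · exact hi
  have hm : ContDiff ℝ ∞ fun z : Fin 2 → ℝ => z 0 * z 1 :=
    (contDiff_apply ℝ ℝ 0).mul (contDiff_apply ℝ ℝ 1)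
  have hK := contDiff_cutoff_mul hG
  -- This is `F = (x y - 1) G` times the cut-off, which makes it valid and smooth on the whole
  -- plane. It is arranged without subtraction so that `op_fun_add` and `op_fun_mul` apply; at `(u,
  -- v)` the two `G` terms cancel.
  have key : (fun z : Fin 2 → ℝ => cutoff (z 0 * z 1) * F z + cutoff (z 0 * z 1) * G z) =
      fun z => z 0 * z 1 * (cutoff (z 0 * z 1) * G z) := by
    funext z
    by_cases hz : z 0 = 0
    · simp [hz, cutoff_of_le]
    · have e := hFg z ![z 0, (z 0)⁻¹]
      rw [h _ hz] at e
      simp only [Fin.sum_univ_two, Matrix.cons_val_zero, Matrix.cons_val_one, sub_self, zero_mul,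
        zero_add] at e
      rw [e, hGdef]
      field_simp
      ring
  have h1 := op_congr (A := C) ((contDiff_cutoff_mul_apply.mul hF).add hK) (hm.mul hK) key ![u, v]
  rw [op_fun_add (contDiff_cutoff_mul_apply.mul hF) hK, op_fun_mul contDiff_cutoff_mul_apply hF,
    op_fun_mul hm hK, op_mul, op_cutoff huv] at h1
  simpa [huv] using h1

/-- Independence of the extension: this is what makes evaluation at `(u, v)` compatible with smooth
operations. -/
theorem op_eq_of_hyperbola {F G : (Fin 2 → ℝ) → ℝ} (hF : ContDiff ℝ ∞ F) (hG : ContDiff ℝ ∞ G)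
    (h : ∀ x : ℝ, x ≠ 0 → F ![x, x⁻¹] = G ![x, x⁻¹]) {u v : C} (huv : u * v = 1) :
    op F hF ![u, v] = op G hG ![u, v] := by
  have h0 := op_eq_zero_of_hyperbola (hF.sub hG) (fun x hx => sub_eq_zero.2 (h x hx)) huv
  have h1 := op_fun_add (hF.sub hG) hG ![u, v]
  rw [h0, zero_add] at h1
  rw [← h1]
  exact op_congr _ _ (by simp) _

end CInftyRing

/-! ### Evaluating functions on `ℝ ∖ {0}` at invertible elements -/

namespace SmoothPuncturedLine

open CInftyRing

/-- An extension to the plane of a function on the hyperbola `x y = 1`, which is identified with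
`ℝ ∖ {0}` by the first coordinate. -/
noncomputable def extend (h : SmoothPuncturedLine) (z : Fin 2 → ℝ) : ℝ :=
  cutoff (z 0 * z 1) * Function.extend Subtype.val h 0 (z 0)

theorem extend_hyperbola (h : SmoothPuncturedLine) {x : ℝ} (hx : x ≠ 0) :
    extend h ![x, x⁻¹] = h ⟨x, hx⟩ := by
  have e := Subtype.val_injective.extend_apply h (0 : ℝ → ℝ) (⟨x, hx⟩ : puncturedLine)
  simp only [extend, Matrix.cons_val_zero, Matrix.cons_val_one, mul_inv_cancel₀ hx, cutoff_one,
    one_mul]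
  exact e

/-- Extension by zero is smooth at every nonzero point because `ℝ ∖ {0}` is open; the cut-off
absorbs the possible singularity at `0`. -/
theorem contDiff_extend (h : SmoothPuncturedLine) : ContDiff ℝ ∞ (extend h) := by
  refine contDiff_cutoff_mul (G := fun z => Function.extend Subtype.val h 0 (z 0)) fun z hz => ?_
  have h1 : ContMDiffAt 𝓘(ℝ, ℝ) 𝓘(ℝ, ℝ) ∞ (Function.extend Subtype.val h (0 : ℝ → ℝ)) (z 0) := by
    refine (contMDiffAt_subtype_iff (U := puncturedLine) (x := ⟨z 0, hz⟩)).1 ?_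
    refine (h.contMDiff _).congr_of_eventuallyEq (Filter.Eventually.of_forall fun x => ?_)
    exact Subtype.val_injective.extend_apply h 0 x
  exact h1.contDiffAt.comp z (contDiff_apply ℝ ℝ (0 : Fin 2)).contDiffAt

variable {C : Type u} [CInftyRing C]

/-- The morphism `C^∞(ℝ ∖ {0}) → C` that sends the coordinate to an invertible element `u`. -/
noncomputable def evalAt (u v : C) (huv : u * v = 1) : CInftyHom SmoothPuncturedLine C where
  toFun h := op (extend h) (contDiff_extend h) ![u, v]
  map_op f hf h := by
    rw [op_comp f hf _ fun i => contDiff_extend (h i)]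
    -- Extending does not commute with `f` on the plane (`f` need not fix `0`, for instance), but
    -- both sides restrict to the same function on the hyperbola.
    refine op_eq_of_hyperbola _ _ (fun x hx => ?_) huv
    simp only [extend_hyperbola _ hx]
    rfl

theorem evalAt_restrict_X (u v : C) (huv : u * v = 1) :
    evalAt u v huv (SmoothLine.restrict SmoothLine.X) = u := by
  refine (op_eq_of_hyperbola _ (contDiff_apply ℝ ℝ 0) (fun x hx => ?_) huv).trans
    (op_proj (0 : Fin 2) _)
  exact extend_hyperbola _ hx

/-- The function `x⁻¹` on `ℝ ∖ {0}`. -/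
noncomputable def inv : SmoothPuncturedLine :=
  ⟨fun x => (x : ℝ)⁻¹, fun x => by
    have h : ContMDiffAt 𝓘(ℝ, ℝ) 𝓘(ℝ, ℝ) ∞ (fun y : ℝ => y⁻¹) x :=
      (contDiffAt_inv ℝ x.2).contMDiffAt
    exact contMDiffAt_subtype_iff.2 h⟩

theorem restrict_X_mul_inv : SmoothLine.restrict SmoothLine.X * inv = 1 := by
  ext x
  exact mul_inv_cancel₀ x.2

end SmoothPuncturedLine

/-! ### The two implications for one element `g` -/

namespace CInftyRing

variable {B : Type u} [CInftyRing B]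

theorem substitute_inl (g b : B) : substitute g (Coprod.inl B SmoothLine b) = b :=
  Coprod.desc_inl (CInftyHom.id B) (SmoothLine.evalAt g) b

theorem substitute_inr_X (g : B) :
    substitute g (Coprod.inr B SmoothLine SmoothLine.X) = g :=
  (Coprod.desc_inr (CInftyHom.id B) (SmoothLine.evalAt g) SmoothLine.X).trans
    (SmoothLine.evalAt_X g)

theorem Coprod.mapRight_inl {C : Type v} {D : Type w} [CInftyRing C] [CInftyRing D]
    (ψ : CInftyHom C D) (b : B) : Coprod.mapRight B ψ (Coprod.inl B C b) = Coprod.inl B D b :=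
  Coprod.desc_inl (Coprod.inl B D) ((Coprod.inr B D).comp ψ) b

theorem Coprod.mapRight_inr {C : Type v} {D : Type w} [CInftyRing C] [CInftyRing D]
    (ψ : CInftyHom C D) (c : C) :
    Coprod.mapRight B ψ (Coprod.inr B C c) = Coprod.inr B D (ψ c) :=
  Coprod.desc_inr (Coprod.inl B D) ((Coprod.inr B D).comp ψ) c

/-- The element `g - x` of `B ⊗ C^∞(ℝ)` vanishes at `g`. -/
theorem substitute_inl_sub_inr (g : B) :
    substitute g (Coprod.inl B SmoothLine g - Coprod.inr B SmoothLine SmoothLine.X) = 0 :=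
  (map_sub (substitute g).toRingHom _ _).trans
    (sub_eq_zero.2 ((substitute_inl g g).trans (substitute_inr_X g).symm))

/-- The witness is always `g - x`; its inverse over `ℝ ∖ {0}` comes from writing `1` as a multiple
of `g x - 1` and substituting `1/x` for `x`. -/
theorem isInfNilpotent_of_subsingleton_invert {g : B} (h : Subsingleton (Invert g)) :
    IsInfNilpotent g := by
  refine ⟨_, substitute_inl_sub_inr g, ?_⟩
  have h1 : (1 : Coprod B SmoothLine) ∈ invertIdeal g :=
    Ideal.Quotient.eq_zero_iff_mem.1 (h.elim _ _)
  obtain ⟨q, hq⟩ := Ideal.mem_span_singleton'.1 h1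
  set y : Coprod B SmoothPuncturedLine := Coprod.inr B _ SmoothPuncturedLine.inv
  set x : Coprod B SmoothPuncturedLine :=
    Coprod.inr B _ (SmoothLine.restrict SmoothLine.X)
  have hxy : x * y = 1 := by
    refine (map_mul (Coprod.inr B SmoothPuncturedLine).toRingHom _ _).symm.trans ?_
    rw [SmoothPuncturedLine.restrict_X_mul_inv, map_one]
  -- The substitution `x ↦ 1/x`, which makes sense only with values over `ℝ ∖ {0}`.
  let d := (Coprod.desc (Coprod.inl B SmoothPuncturedLine) (SmoothLine.evalAt y)).toRingHom
  have hl : d (Coprod.inl B SmoothLine g) = Coprod.inl B SmoothPuncturedLine g :=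
    Coprod.desc_inl _ _ g
  have hr : d (Coprod.inr B SmoothLine SmoothLine.X) = y :=
    (Coprod.desc_inr _ _ _).trans (SmoothLine.evalAt_X y)
  have hd := congrArg d hq
  rw [map_mul, map_sub, map_mul, map_one, hl, hr] at hd
  have hf : Coprod.mapRight B SmoothLine.restrict
      (Coprod.inl B SmoothLine g - Coprod.inr B SmoothLine SmoothLine.X) =
        Coprod.inl B SmoothPuncturedLine g - x :=
    (map_sub (Coprod.mapRight B SmoothLine.restrict).toRingHom _ _).trans
      (congrArg₂ _ (Coprod.mapRight_inl _ g) (Coprod.mapRight_inr _ _))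
  rw [hf]
  refine IsUnit.of_mul_eq_one (y * d q) ?_
  -- Since `x y = 1`, `(g - x) y = g y - 1`, and `hd` says that `d q` is inverse to this.
  linear_combination hd - d q * hxy

/-- For a morphism `ι : B → C` with `ι g` invertible, `f ↦ ι (f(g))` factors through the
restriction `B ⊗ C^∞(ℝ) → B ⊗ C^∞(ℝ ∖ {0})`. -/
theorem exists_comp_mapRight_restrict {C : Type v} [CInftyRing C] (ι : CInftyHom B C) (g : B)
    (hg : IsUnit (ι g)) :
    ∃ d : CInftyHom (Coprod B SmoothPuncturedLine) C,
      d.comp (Coprod.mapRight B SmoothLine.restrict) = ι.comp (substitute g) := by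
  obtain ⟨v, hv⟩ := hg.exists_right_inv
  refine ⟨Coprod.desc ι (SmoothPuncturedLine.evalAt (ι g) v hv),
    Coprod.hom_ext (fun b => ?_) fun k => ?_⟩
  · simp only [CInftyHom.comp]
    rw [Coprod.mapRight_inl, Coprod.desc_inl, substitute_inl]
  · refine congrArg (fun θ : CInftyHom SmoothLine C => θ k) (SmoothLine.hom_ext
      (φ := ((Coprod.desc ι (SmoothPuncturedLine.evalAt (ι g) v hv)).comp
        (Coprod.mapRight B SmoothLine.restrict)).comp (Coprod.inr B SmoothLine))
      (ψ := (ι.comp (substitute g)).comp (Coprod.inr B SmoothLine)) ?_)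
    simp only [CInftyHom.comp]
    rw [Coprod.mapRight_inr, Coprod.desc_inr, substitute_inr_X,
      SmoothPuncturedLine.evalAt_restrict_X]

/-- Evaluation at `g` followed by `B → B{g⁻¹}` sends the witness to `0`, while its factorization
over `ℝ ∖ {0}` sends it to a unit; a ring in which `0` is a unit is trivial. -/
theorem IsInfNilpotent.subsingleton_invert {g : B} (h : IsInfNilpotent g) :
    Subsingleton (Invert g) := by
  obtain ⟨f, hf, hu⟩ := h
  let ι : CInftyHom B (Invert g) :=
    (CInftyHom.quotMk (invertIdeal g)).comp (Coprod.inl B SmoothLine)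
  obtain ⟨d, hd⟩ := exists_comp_mapRight_restrict ι g (invert_universal (B := B) g).1
  have h0 : d (Coprod.mapRight B SmoothLine.restrict f) = 0 :=
    (congrArg (fun θ : CInftyHom (Coprod B SmoothLine) (Invert g) => θ f) hd).trans
      ((congrArg ι hf).trans (map_zero ι.toRingHom))
  have h1 : IsUnit (d (Coprod.mapRight B SmoothLine.restrict f)) := hu.map d.toRingHom
  rw [h0] at h1
  exact subsingleton_of_zero_eq_one (isUnit_zero_iff.1 h1)

end CInftyRing

theorem mainTheorem8 {A : Type*} [CInftyRing A] (I : Ideal A) (g : A) :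
    g ∈ CInftyRing.infRadical I ↔ CInftyRing.IsInfNilpotent (Ideal.Quotient.mk I g) := by
  exact ⟨CInftyRing.isInfNilpotent_of_subsingleton_invert,
    CInftyRing.IsInfNilpotent.subsingleton_invert⟩
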